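/- Let $p>286$ be a prime, let $B_p$ be the quaternion algebra over $\mathbb Q$ ramified exactly at $p$ and $\infty$, with reduced trace $\mathrm{Tr}$ and reduced norm $\mathrm{Nr}$, and let $\mathcal O,\mathcal O'$ be maximal orders of $B_p$. For an order $R$ of $B_p$ let $R^T=\{2u-\mathrm{Tr}(u): u\in R\}$ be its Gross lattice. An element $v\neq 0$ of a lattice $\Lambda\subset B_p$ is called primitive if $v=aw$ with $w\in\Lambda$ and $a\in\mathbb Z$ forces $a=\pm1$; a number $k$ is optimally represented by $\Lambda$ if $k=\mathrm{Nr}(v)$ for some primitive $v\in\Lambda$; and $\theta'_\Lambda(k)=\frac12\#\{v\in\Lambda \text{ primitive}:\mathrm{Nr}(v)=k\}$ denotes the optimal multiplicity of $k$. The $i$-th successive minimum of $\Lambda$ is the least $D$ such that $\Lambda$ contains $i$ linearly independent elements of norm at most $D$. Let $D_1,D_2,D_3$ be the successive minima of $\mathcal O^T$, and let $x,y,z\in\mathcal O^T$ be linearly independent with $\mathrm{Nr}(x)=D_1$, $\mathrm{Nr}(y)=D_2$, $\mathrm{Nr}(z)=D_3$. Suppose that $D_1$, $D_2$, $\mathrm{Nr}(x+y)$,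 $\mathrm{Nr}(x-y)$ and $D_3$ are all optimally represented by $\mathcal O'^T$, that $\theta'_{\mathcal O^T}(D_3)\le\theta'_{\mathcal O'^T}(D_3)$, and that $D_1D_2<\tfrac{16}{3}p$ and $D_1\ge 15$. Then $\mathcal O$ and $\mathcal O'$ are of the same type, i.e. there is a non-zero $c\in B_p$ with $c\,\mathcal O\,c^{-1}=\mathcal O'$. -/

import Mathlib

open scoped Quaternion

namespace QuatOrder

/-- The extension of scalars to `K` of the rational quaternion algebra `(a, b / ℚ)`, that is
`(a, b / K)`, is a division algebra. -/
def IsDivisionOver (K : Type) [Field K] [Algebra ℚ K] (a b : ℚ) : Prop :=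
  ∀ x : ℍ[K, algebraMap ℚ K a, algebraMap ℚ K b], x ≠ 0 → IsUnit x

/-- The rational quaternion algebra `ℍ[ℚ, a, b]`, with `i ^ 2 = a`, `j ^ 2 = b`, `i j = - j i`,
is ramified exactly at the prime `p` and at the infinite place. Every quaternion algebra over `ℚ`
has the form `ℍ[ℚ, a, b]` with `a` and `b` nonzero. -/
structure IsRamifiedExactlyAt (p : ℕ) (a b : ℚ) : Prop where
  left_ne_zero : a ≠ 0
  right_ne_zero : b ≠ 0
  finite_places : ∀ (l : ℕ) [Fact l.Prime], IsDivisionOver ℚ_[l] a b ↔ l = p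
  infinite_place : IsDivisionOver ℝ a b

variable {a b : ℚ}

/-- The reduced trace `x + x̄`, as a rational number. -/
def trd (x : ℍ[ℚ, a, b]) : ℚ := (x + star x).re

/-- The reduced norm `x x̄`, as a rational number. -/
def nrd (x : ℍ[ℚ, a, b]) : ℚ := (x * star x).re

theorem trd_eq (x : ℍ[ℚ, a, b]) : trd x = 2 * x.re := by
  simp [trd, two_mul]

theorem coe_trd (x : ℍ[ℚ, a, b]) : (trd x : ℍ[ℚ, a, b]) = x + star x := by
  ext <;> simp [trd]

theorem coe_nrd (x : ℍ[ℚ, a, b]) : (nrd x : ℍ[ℚ, a, b]) = x * star x := by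
  ext <;> simp [nrd] <;> ring

/-- An order: a subring generated, as a `ℤ`-module, by four linearly independent elements. -/
def IsOrder (O : Subring ℍ[ℚ, a, b]) : Prop :=
  ∃ v : Fin 4 → ℍ[ℚ, a, b], LinearIndependent ℚ v ∧
    O.toAddSubgroup = AddSubgroup.closure (Set.range v)

/-- A maximal order: an order not properly contained in any other order. -/
def IsMaximalOrder (O : Subring ℍ[ℚ, a, b]) : Prop := Maximal IsOrder O

/-- Two orders are of the same type if they are conjugate by an invertible element. -/
def SameType (O O' : Subring ℍ[ℚ, a, b]) : Prop :=
  ∃ c : (ℍ[ℚ, a, b])ˣ,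
    (fun u : ℍ[ℚ, a, b] => (c : ℍ[ℚ, a, b]) * u * ((c⁻¹ : (ℍ[ℚ, a, b])ˣ) : ℍ[ℚ, a, b])) ''
      (O : Set ℍ[ℚ, a, b]) = (O' : Set ℍ[ℚ, a, b])

/-- The Gross lattice `{2 x - Tr x | x ∈ O}`. -/
def grossLattice (O : Subring ℍ[ℚ, a, b]) : AddSubgroup ℍ[ℚ, a, b] where
  carrier := {y | ∃ x ∈ O, y = 2 * x - (trd x : ℍ[ℚ, a, b])}
  zero_mem' := ⟨0, O.zero_mem, by ext <;> simp [trd_eq]⟩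
  add_mem' := by
    rintro _ _ ⟨x, hx, rfl⟩ ⟨y, hy, rfl⟩
    refine ⟨x + y, O.add_mem hx hy, ?_⟩
    simp only [coe_trd, star_add]
    noncomm_ring
  neg_mem' := by
    rintro _ ⟨x, hx, rfl⟩
    refine ⟨-x, O.neg_mem hx, ?_⟩
    simp only [coe_trd, star_neg]
    noncomm_ring

/-- `x` is a primitive element of the lattice `L`. -/
def IsPrimitive (L : AddSubgroup ℍ[ℚ, a, b]) (x : ℍ[ℚ, a, b]) : Prop :=
  x ∈ L ∧ x ≠ 0 ∧ ∀ y ∈ L, ∀ m : ℤ, m • y = x → m = 1 ∨ m = -1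

/-- `k` is optimally represented by the lattice `L`: it is the norm of a primitive element. -/
def OptimallyRepresents (L : AddSubgroup ℍ[ℚ, a, b]) (k : ℚ) : Prop :=
  ∃ x, IsPrimitive L x ∧ nrd x = k

/-- The optimal multiplicity of `k`: half the number of primitive elements of norm `k`. -/
noncomputable def optimalMultiplicity (L : AddSubgroup ℍ[ℚ, a, b]) (k : ℚ) : ℚ :=
  ({x | IsPrimitive L x ∧ nrd x = k}.ncard : ℚ) / 2

/-- `D` is the `n`-th successive minimum of `L`: the least `D` such that `L` contains `n`
linearly independent elements of norm at most `D`. -/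
def IsSuccessiveMinimum (L : AddSubgroup ℍ[ℚ, a, b]) (n : ℕ) (D : ℚ) : Prop :=
  IsLeast {d : ℚ | ∃ v : Fin n → ℍ[ℚ, a, b], LinearIndependent ℚ v ∧
    ∀ i, v i ∈ L ∧ nrd (v i) ≤ d} D

end QuatOrder

/-!
The proof compares Gram determinants. Write `⟨x, y⟩ = Tr (x ȳ) / 2`. For `x`, `y` in the Gross
lattice of an order of `B_p`, the number `Nr x Nr y - ⟨x, y⟩ ^ 2` is a non-negative multiple of
`4 p`: modulo `4` this is a computation with `x = 2 u - Tr u`, and it is divisible by `p` because a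
binary form of Gram determinant prime to `p` represents `-1` modulo `p`, which would produce zero
divisors in the division algebra `B_p ⊗ ℚ_p` (`IsDivisionOver.dvd_gram`). Since
`D₁ D₂ < 16 p / 3 < 8 p`, independent vectors of norms `D₁` and `D₂` have Gram determinant exactly
`4 p`.

Let `x = 2 u - Tr u` and `y = 2 v - Tr v` have Gram determinant `4 p`. The order `ℤ[u, v]` then has
reduced discriminant `p`, the smallest possible one, so every order containing `u` and `v` is
spanned by `1, u, v, u v` (`IsOrder.exists_int_coeffs`). Hence two orders whose Gross lattices
contain isometric pairs of this kind are conjugate, by the Skolem–Noether theorem in the explicit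
form of `exists_unit_conj` (`sameType_of_gram_eq`).

It remains to find such a pair for `O'`. Primitive vectors `x'`, `y'` of norms `D₁`, `D₂` in its
Gross lattice have Gram determinant `4 p`, hence `⟨x', y'⟩ = ± ⟨x, y⟩`, unless they are
proportional. In that case `D₁ = D₂`, and the shorter one of `x ± y` takes the place of `y`
(`sameType_of_nrd_eq_nrd`).
-/

namespace QuatOrder

variable {a b : ℚ}

/-- The bilinear form `⟨x, y⟩ = Tr (x ȳ) / 2` whose quadratic form is the reduced norm. -/
def pairing (x y : ℍ[ℚ, a, b]) : ℚ := (x * star y).re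

theorem pairing_eq (x y : ℍ[ℚ, a, b]) : pairing x y =
    x.re * y.re - a * (x.imI * y.imI) - b * (x.imJ * y.imJ) + a * b * (x.imK * y.imK) := by
  simp [pairing]; ring

theorem nrd_eq (x : ℍ[ℚ, a, b]) : nrd x =
    x.re ^ 2 - a * x.imI ^ 2 - b * x.imJ ^ 2 + a * b * x.imK ^ 2 := by
  simp [nrd]; ring

theorem nrd_add (x y : ℍ[ℚ, a, b]) : nrd (x + y) = nrd x + nrd y + 2 * pairing x y := by
  simp [nrd_eq, pairing_eq]; ring

theorem nrd_sub (x y : ℍ[ℚ, a, b]) : nrd (x - y) = nrd x + nrd y - 2 * pairing x y := by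
  simp [nrd_eq, pairing_eq]; ring

theorem pairing_comm (x y : ℍ[ℚ, a, b]) : pairing x y = pairing y x := by
  simp [pairing_eq]; ring

theorem pairing_neg_right (x y : ℍ[ℚ, a, b]) : pairing x (-y) = -pairing x y := by
  simp [pairing_eq]; ring

theorem pairing_add_right (x y z : ℍ[ℚ, a, b]) :
    pairing x (y + z) = pairing x y + pairing x z := by
  simp [pairing_eq]; ring

theorem pairing_sub_right (x y z : ℍ[ℚ, a, b]) :
    pairing x (y - z) = pairing x y - pairing x z := by
  simp [pairing_eq]; ring

theorem pairing_self (x : ℍ[ℚ, a, b]) : pairing x x = nrd x := rfl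

theorem nrd_neg (x : ℍ[ℚ, a, b]) : nrd (-x) = nrd x := by
  simp [nrd_eq]

/-! ### Positivity at the infinite place -/

theorem IsDivisionOver.neg_of_real (h : IsDivisionOver ℝ a b) : a < 0 ∧ b < 0 := by
  constructor
  · by_contra! ha
    -- For `r = √a` the relation `(i + r) (i - r) = 0` exhibits a zero divisor.
    set r := Real.sqrt (a : ℝ)
    have hr : r * r = a := Real.mul_self_sqrt (by exact_mod_cast ha)
    have hu := h ⟨r, 1, 0, 0⟩ (fun h0 => by simpa using congrArg QuaternionAlgebra.imI h0)
    have h0 : (⟨r, 1, 0, 0⟩ : ℍ[ℝ, algebraMap ℚ ℝ a, algebraMap ℚ ℝ b]) * ⟨-r, 1, 0, 0⟩ = 0 := by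
      ext <;> simp [hr]
    have := (hu.mul_right_eq_zero).1 h0
    simpa using congrArg QuaternionAlgebra.imI this
  · by_contra! hb
    set r := Real.sqrt (b : ℝ)
    have hr : r * r = b := Real.mul_self_sqrt (by exact_mod_cast hb)
    have hu := h ⟨r, 0, 1, 0⟩ (fun h0 => by simpa using congrArg QuaternionAlgebra.imJ h0)
    have h0 : (⟨r, 0, 1, 0⟩ : ℍ[ℝ, algebraMap ℚ ℝ a, algebraMap ℚ ℝ b]) * ⟨-r, 0, 1, 0⟩ = 0 := by
      ext <;> simp [hr]
    have := (hu.mul_right_eq_zero).1 h0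
    simpa using congrArg QuaternionAlgebra.imJ this

theorem nrd_pos (ha : a < 0) (hb : b < 0) {x : ℍ[ℚ, a, b]} (hx : x ≠ 0) : 0 < nrd x := by
  have hab : 0 < a * b := mul_pos_of_neg_of_neg ha hb
  rw [nrd_eq]
  by_contra! h
  apply hx
  have h1 := sq_nonneg x.re
  have h2 : 0 ≤ -a * x.imI ^ 2 := mul_nonneg (by linarith) (sq_nonneg _)
  have h3 : 0 ≤ -b * x.imJ ^ 2 := mul_nonneg (by linarith) (sq_nonneg _)
  have h4 : 0 ≤ a * b * x.imK ^ 2 := mul_nonneg hab.le (sq_nonneg _)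
  have e1 : x.re ^ 2 = 0 := by linarith
  have e2 : -a * x.imI ^ 2 = 0 := by linarith
  have e3 : -b * x.imJ ^ 2 = 0 := by linarith
  have e4 : a * b * x.imK ^ 2 = 0 := by linarith
  simp only [mul_eq_zero, neg_eq_zero, ha.ne, hb.ne, false_or, or_self,
    pow_eq_zero_iff two_ne_zero] at e1 e2 e3 e4
  ext <;> assumption

theorem isUnit_of_ne_zero (ha : a < 0) (hb : b < 0) {x : ℍ[ℚ, a, b]} (hx : x ≠ 0) : IsUnit x := by
  have hn := (nrd_pos ha hb hx).ne'
  refine ⟨⟨x, (nrd x)⁻¹ • star x, ?_, ?_⟩, rfl⟩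
  · rw [mul_smul_comm, ← coe_nrd]
    ext <;> simp [hn]
  · rw [smul_mul_assoc, QuaternionAlgebra.star_mul_eq_coe]
    have : (star x * x).re = nrd x := by simp [nrd]
    rw [this]
    ext <;> simp [hn]

/-- The component of `y` orthogonal to `x`, scaled by `nrd x`. -/
def orthComponent (x y : ℍ[ℚ, a, b]) : ℍ[ℚ, a, b] := nrd x • y - pairing x y • x

theorem nrd_orthComponent (x y : ℍ[ℚ, a, b]) : nrd (orthComponent x y) =
    nrd x * (nrd x * nrd y - pairing x y ^ 2) := by
  simp only [orthComponent, nrd_eq, pairing_eq, QuaternionAlgebra.re_sub,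
    QuaternionAlgebra.imI_sub, QuaternionAlgebra.imJ_sub, QuaternionAlgebra.imK_sub,
    QuaternionAlgebra.re_smul, QuaternionAlgebra.imI_smul, QuaternionAlgebra.imJ_smul,
    QuaternionAlgebra.imK_smul, smul_eq_mul]
  ring

theorem gram_pos_or_proportional (ha : a < 0) (hb : b < 0) (x y : ℍ[ℚ, a, b]) (hx : x ≠ 0) :
    0 < nrd x * nrd y - pairing x y ^ 2 ∨ nrd x • y = pairing x y • x := by
  by_cases h : orthComponent x y = 0
  · exact .inr (sub_eq_zero.1 h)
  · have hpos := nrd_pos ha hb h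
    rw [nrd_orthComponent] at hpos
    exact .inl (pos_of_mul_pos_right hpos (nrd_pos ha hb hx).le)

/-! ### Integrality of traces and norms -/

theorem mul_self_eq (u : ℍ[ℚ, a, b]) : u * u = trd u • u - (nrd u : ℍ[ℚ, a, b]) := by
  ext <;> simp <;> simp only [trd_eq, nrd_eq] <;> ring

theorem IsOrder.isIntegral {O : Subring ℍ[ℚ, a, b]} (hO : IsOrder O) {u : ℍ[ℚ, a, b]}
    (hu : u ∈ O) : IsIntegral ℤ u := by
  obtain ⟨v, -, hv⟩ := hO
  refine IsIntegral.of_mem_of_fg (subalgebraOfSubring O) ?_ u hu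
  refine ⟨(Set.finite_range v).toFinset, ?_⟩
  apply Submodule.toAddSubgroup_injective
  rw [Set.Finite.coe_toFinset, Submodule.span_int_eq_addSubgroupClosure, ← hv]
  rfl

open Polynomial in
/-- An element of `ℚ` is integral only if it is an integer; otherwise the characteristic polynomial
`X ^ 2 - Tr u X + Nr u` divides every rational polynomial vanishing at `u`, so it is integral by
Gauss's lemma. -/
theorem exists_int_trd_nrd {u : ℍ[ℚ, a, b]} (hu : IsIntegral ℤ u) :
    (∃ t : ℤ, trd u = t) ∧ ∃ n : ℤ, nrd u = n := by
  by_cases hr : ∃ r : ℚ, u = algebraMap ℚ ℍ[ℚ, a, b] r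
  · obtain ⟨r, rfl⟩ := hr
    have hinj : Function.Injective (algebraMap ℚ ℍ[ℚ, a, b]) :=
      FaithfulSMul.algebraMap_injective _ _
    obtain ⟨m, hm⟩ := IsIntegrallyClosed.isIntegral_iff.1 ((isIntegral_algebraMap_iff hinj).1 hu)
    simp only [eq_intCast] at hm
    subst hm
    refine ⟨⟨2 * m, ?_⟩, ⟨m ^ 2, ?_⟩⟩
    · rw [trd_eq]; simp
    · rw [nrd_eq]; simp
  · obtain ⟨f, hf, hfu⟩ := hu
    set q : ℚ[X] := X ^ 2 + (C (-trd u) * X + C (nrd u)) with hq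
    have hqdeg : (C (-trd u) * X + C (nrd u)).degree < ((2 : ℕ) : WithBot ℕ) :=
      lt_of_le_of_lt degree_linear_le (by norm_num)
    have hqm : q.Monic := monic_X_pow_add hqdeg
    have hqu : aeval u q = 0 := by
      simp only [hq, map_add, map_mul, map_pow, aeval_X, aeval_C]
      rw [pow_two, mul_self_eq]
      ext <;> simp
    have hfu' : aeval u (f.map (algebraMap ℤ ℚ)) = 0 := by
      rw [aeval_map_algebraMap]; exact hfu
    have hmod : aeval u (f.map (algebraMap ℤ ℚ) %ₘ q) = 0 := by
      have h := congrArg (aeval u) (modByMonic_add_div (f.map (algebraMap ℤ ℚ)) q)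
      rw [map_add, map_mul, hqu, zero_mul, add_zero, hfu'] at h
      exact h
    have hdeg : (f.map (algebraMap ℤ ℚ) %ₘ q).degree ≤ 1 := by
      have h := degree_modByMonic_lt (f.map (algebraMap ℤ ℚ)) hqm
      have h2 : q.degree = ((2 : ℕ) : WithBot ℕ) := by
        rw [hq, degree_add_eq_left_of_degree_lt (by rwa [degree_X_pow]), degree_X_pow]
      rw [h2] at h
      exact Order.le_of_lt_succ h
    set g := f.map (algebraMap ℤ ℚ) %ₘ q with hg
    rw [eq_X_add_C_of_degree_le_one hdeg] at hmod
    simp only [map_add, map_mul, aeval_X, aeval_C] at hmod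
    have hc1 : g.coeff 1 = 0 := by
      by_contra hc
      refine hr ⟨-(g.coeff 1)⁻¹ * g.coeff 0, ?_⟩
      have hre := congrArg QuaternionAlgebra.re hmod
      have hI := congrArg QuaternionAlgebra.imI hmod
      have hJ := congrArg QuaternionAlgebra.imJ hmod
      have hK := congrArg QuaternionAlgebra.imK hmod
      simp [hc] at hre hI hJ hK
      ext
      · simp; field_simp; linarith
      all_goals simp [hI, hJ, hK]
    have hc0 : g.coeff 0 = 0 := by
      rw [hc1] at hmod
      have hre := congrArg QuaternionAlgebra.re hmod
      simpa using hre
    have hg0 : g = 0 := by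
      rw [eq_X_add_C_of_degree_le_one hdeg, hc1, hc0]; simp
    have hdvd : q ∣ f.map (algebraMap ℤ ℚ) := (modByMonic_eq_zero_iff_dvd hqm).1 hg0
    obtain ⟨g', hg'⟩ := IsIntegrallyClosed.eq_map_mul_C_of_dvd ℚ hf hdvd
    rw [hqm.leadingCoeff, C_1, mul_one] at hg'
    constructor
    · refine ⟨-g'.coeff 1, ?_⟩
      have h := congrArg (fun f => coeff f 1) hg'
      simp [hq, coeff_C, coeff_X_pow] at h
      push_cast; linarith
    · refine ⟨g'.coeff 0, ?_⟩
      have h := congrArg (fun f => coeff f 0) hg'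
      simp [hq, coeff_X_pow] at h
      exact h.symm

theorem IsOrder.exists_int_trd {O : Subring ℍ[ℚ, a, b]} (hO : IsOrder O) {u : ℍ[ℚ, a, b]}
    (hu : u ∈ O) : ∃ t : ℤ, trd u = t := (exists_int_trd_nrd (hO.isIntegral hu)).1

theorem IsOrder.exists_int_nrd {O : Subring ℍ[ℚ, a, b]} (hO : IsOrder O) {u : ℍ[ℚ, a, b]}
    (hu : u ∈ O) : ∃ n : ℤ, nrd u = n := (exists_int_trd_nrd (hO.isIntegral hu)).2

theorem IsOrder.exists_int_two_mul_pairing {O : Subring ℍ[ℚ, a, b]} (hO : IsOrder O)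
    {u v : ℍ[ℚ, a, b]} (hu : u ∈ O) (hv : v ∈ O) : ∃ m : ℤ, 2 * pairing u v = m := by
  obtain ⟨n, hn⟩ := hO.exists_int_nrd (O.add_mem hu hv)
  obtain ⟨n₁, h₁⟩ := hO.exists_int_nrd hu
  obtain ⟨n₂, h₂⟩ := hO.exists_int_nrd hv
  refine ⟨n - n₁ - n₂, ?_⟩
  rw [nrd_add] at hn
  push_cast
  linarith

/-! ### Divisibility of Gram determinants by `p` -/

theorem exists_binary_form_eq_neg_one {p : ℕ} [Fact p.Prime] (hp : p ≠ 2) {n₁ n₂ s : ZMod p}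
    (h : n₁ * n₂ - s ^ 2 ≠ 0) : ∃ Y Z : ZMod p, n₁ * Y ^ 2 + 2 * s * Y * Z + n₂ * Z ^ 2 = -1 := by
  have hodd : Fintype.card (ZMod p) % 2 = 1 := by
    rw [ZMod.card]; exact Nat.odd_iff.1 ((Fact.out : p.Prime).odd_of_ne_two hp)
  have main : ∀ n₁ n₂ : ZMod p, n₁ ≠ 0 → n₁ * n₂ - s ^ 2 ≠ 0 →
      ∃ Y Z : ZMod p, n₁ * Y ^ 2 + 2 * s * Y * Z + n₂ * Z ^ 2 = -1 := by
    intro n₁ n₂ h1 h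
    open Polynomial in
    obtain ⟨α, β, hαβ⟩ := FiniteField.exists_root_sum_quadratic
      (f := C (1 : ZMod p) * X ^ 2 + C 0 * X + C n₁)
      (g := C (n₁ * n₂ - s ^ 2) * X ^ 2 + C 0 * X + C 0)
      (degree_quadratic one_ne_zero) (degree_quadratic h) hodd
    simp at hαβ
    refine ⟨(α - s * β) / n₁, β, ?_⟩
    apply mul_left_cancel₀ h1
    field_simp
    linear_combination hαβ
  by_cases h1 : n₁ = 0
  · by_cases h2 : n₂ = 0
    · have hs : s ≠ 0 := by rintro rfl; simp [h1] at h
      have h2' : (2 : ZMod p) ≠ 0 := by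
        have : Fact (2 < p) := ⟨lt_of_le_of_ne (Fact.out : p.Prime).two_le hp.symm⟩
        intro h0
        have := ZMod.neg_one_ne_one (n := p)
        apply this
        linear_combination (-1 : ZMod p) * h0
      refine ⟨1, -(2 * s)⁻¹, ?_⟩
      subst h1 h2
      field_simp
      ring
    · obtain ⟨Y, Z, hYZ⟩ := main n₂ n₁ h2 (by rwa [mul_comm])
      exact ⟨Z, Y, by linear_combination hYZ⟩
  · exact main n₁ n₂ h1 h

open Polynomial in
theorem exists_padicInt_mul_self_eq {p : ℕ} [Fact p.Prime] (hp : p ≠ 2) (n : ℤ)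
    (hn : (p : ℤ) ∣ n - 1) : ∃ r : ℤ_[p], r * r = n ∧ r ≠ 0 := by
  have hp2 : ‖(2 : ℤ_[p])‖ = 1 := by
    have h := PadicInt.norm_int_lt_one_iff_dvd (p := p) 2
    have h2 : ¬ (p : ℤ) ∣ 2 := by
      intro hd
      have : p ∣ 2 := by exact_mod_cast hd
      exact hp ((Nat.prime_dvd_prime_iff_eq Fact.out Nat.prime_two).1 this)
    have h3 := (not_congr h).2 h2
    exact le_antisymm (PadicInt.norm_le_one _) (by simpa using h3)
  have hn1 : ‖((1 - n : ℤ) : ℤ_[p])‖ < 1 :=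
    (PadicInt.norm_int_lt_one_iff_dvd _).2 (by rw [← dvd_neg]; simpa using hn)
  obtain ⟨r, hr, -⟩ := hensels_lemma (p := p) (F := (X ^ 2 - C (n : ℤ_[p]))) (a := (1 : ℤ_[p]))
    (by simpa [one_add_one_eq_two, hp2] using hn1)
  have hr2 : r * r = n := by
    simp at hr
    linear_combination hr
  refine ⟨r, hr2, ?_⟩
  rintro rfl
  have hn0 : (n : ℤ_[p]) = 0 := by rw [← hr2]; simp
  push_cast at hn1
  rw [hn0] at hn1
  simp at hn1

/-- A form over `ℤ` of Gram determinant prime to `p` represents some `n ≡ -1 mod p`. If the form is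
the norm form on a plane of trace zero elements, `-n` is a square `r ^ 2` in `ℤ_p`, and an
element `v` of norm `n` gives the zero divisor `r + v` over `ℚ_p`. -/
theorem IsDivisionOver.dvd_gram {p : ℕ} [Fact p.Prime] (hp : p ≠ 2)
    (hdiv : IsDivisionOver ℚ_[p] a b) {x y : ℍ[ℚ, a, b]} (hx : x.re = 0) (hy : y.re = 0)
    {n₁ n₂ s : ℤ} (h₁ : nrd x = n₁) (h₂ : nrd y = n₂) (hs : pairing x y = s) :
    (p : ℤ) ∣ n₁ * n₂ - s ^ 2 := by
  by_contra hnd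
  have hne : (n₁ : ZMod p) * n₂ - (s : ZMod p) ^ 2 ≠ 0 := by
    intro h
    apply hnd
    rw [← ZMod.intCast_zmod_eq_zero_iff_dvd]
    push_cast
    exact h
  obtain ⟨Y, Z, hYZ⟩ := exists_binary_form_eq_neg_one hp hne
  obtain ⟨Y, rfl⟩ := ZMod.intCast_surjective Y
  obtain ⟨Z, rfl⟩ := ZMod.intCast_surjective Z
  set n : ℤ := n₁ * Y ^ 2 + 2 * s * Y * Z + n₂ * Z ^ 2 with hn
  have hn1 : (p : ℤ) ∣ -n - 1 := by
    rw [← ZMod.intCast_zmod_eq_zero_iff_dvd]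
    push_cast [hn]
    linear_combination -hYZ
  obtain ⟨r, hr, hr0⟩ := exists_padicInt_mul_self_eq hp (-n) hn1
  have hrq : (r : ℚ_[p]) * r = -n := by
    have := congrArg (fun t : ℤ_[p] => (t : ℚ_[p])) hr
    simpa using this
  set i : ℚ := Y * x.imI + Z * y.imI with hi
  set j : ℚ := Y * x.imJ + Z * y.imJ with hj
  set k : ℚ := Y * x.imK + Z * y.imK with hk
  have hnorm : -a * i ^ 2 - b * j ^ 2 + a * b * k ^ 2 = n := by
    rw [nrd_eq, hx] at h₁
    rw [nrd_eq, hy] at h₂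
    rw [pairing_eq, hx, hy] at hs
    push_cast [hn]
    rw [hi, hj, hk]
    linear_combination (Y : ℚ) ^ 2 * h₁ + (Z : ℚ) ^ 2 * h₂ + 2 * (Y : ℚ) * Z * hs
  have hnormp : -(a : ℚ_[p]) * i ^ 2 - b * j ^ 2 + a * b * k ^ 2 = n := by
    exact_mod_cast congrArg (fun q : ℚ => (q : ℚ_[p])) hnorm
  have hu := hdiv ⟨r, i, j, k⟩ (fun h0 => by
    have := congrArg QuaternionAlgebra.re h0
    simp at this
    exact hr0 this)
  have h0 : (⟨r, i, j, k⟩ : ℍ[ℚ_[p], algebraMap ℚ ℚ_[p] a, algebraMap ℚ ℚ_[p] b]) *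
      ⟨r, -i, -j, -k⟩ = 0 := by
    ext
    · simp
      linear_combination hrq + hnormp
    all_goals simp; ring
  have h := (hu.mul_right_eq_zero).1 h0
  have := congrArg QuaternionAlgebra.re h
  simp at this
  exact hr0 this

/-! ### Conjugating pairs of trace zero elements -/

theorem mul_self_of_re_eq_zero {x : ℍ[ℚ, a, b]} (hx : x.re = 0) :
    x * x = ((-nrd x : ℚ) : ℍ[ℚ, a, b]) := by
  rw [mul_self_eq, trd_eq, hx]; ext <;> simp

theorem mul_add_mul_of_re_eq_zero {x y : ℍ[ℚ, a, b]} (hx : x.re = 0) (hy : y.re = 0) :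
    x * y + y * x = ((-(pairing x y + pairing x y) : ℚ) : ℍ[ℚ, a, b]) := by
  ext <;> simp [pairing_eq, hx, hy] <;> ring

theorem eq_zero_of_mul_mul_eq (ha : a < 0) (hb : b < 0) {u v : ℍ[ℚ, a, b]} (h : u * v = 0)
    (hu : u ≠ 0) : v = 0 :=
  ((isUnit_of_ne_zero ha hb hu).mul_right_eq_zero).1 h

/-- Trace zero elements of equal norm are conjugate: for every `q` the element `x' q + q x`
intertwines `x` and `x'`, and it is non-zero for `q = 1` or for `q` not commuting with `x`. -/
theorem exists_intertwining {x x' : ℍ[ℚ, a, b]}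
    (hx : x.re = 0) (hx' : x'.re = 0) (h : nrd x' = nrd x) (q : ℍ[ℚ, a, b]) (hq : x * q ≠ q * x) :
    ∃ c : ℍ[ℚ, a, b], c ≠ 0 ∧ c * x = x' * c := by
  have key : ∀ q, (x' * q + q * x) * x = x' * (x' * q + q * x) := by
    intro q
    have e1 : q * (x * x) = (x' * x') * q := by
      rw [mul_self_of_re_eq_zero hx, mul_self_of_re_eq_zero hx', h]
      exact (QuaternionAlgebra.coe_commutes _ _).symm
    calc (x' * q + q * x) * x = x' * q * x + q * (x * x) := by noncomm_ring
      _ = x' * (x' * q + q * x) := by rw [e1]; noncomm_ring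
  by_cases h1 : x' + x = 0
  · refine ⟨_, ?_, key q⟩
    rw [eq_neg_of_add_eq_zero_left h1]
    intro h2
    apply hq
    have : -(x * q - q * x) = 0 := by rw [← h2]; noncomm_ring
    exact sub_eq_zero.1 (neg_eq_zero.1 this)
  · exact ⟨_, by simpa using h1, key 1⟩

/-- The case of the Skolem–Noether theorem in which one element is fixed. For `y`, `y'` orthogonal
to `x` and of equal norm, `(y' + y) y` commutes with `x` and intertwines `y` and `y'`; it vanishes
only for `y' = -y`, where `x` itself does. -/
theorem exists_intertwining_of_fixed (ha : a < 0) (hb : b < 0) {x y y' : ℍ[ℚ, a, b]}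
    (hx0 : x ≠ 0) (hy0 : y ≠ 0)
    (hx : x.re = 0) (hy : y.re = 0) (hy' : y'.re = 0) (h : nrd y' = nrd y)
    (ho : pairing x y = 0) (ho' : pairing x y' = 0) :
    ∃ c : ℍ[ℚ, a, b], c ≠ 0 ∧ c * x = x * c ∧ c * y = y' * c := by
  have a1 : y * x = -(x * y) := by
    have := mul_add_mul_of_re_eq_zero hx hy
    rw [ho] at this
    exact eq_neg_of_add_eq_zero_right (by simpa using this)
  have a2 : y' * x = -(x * y') := by
    have := mul_add_mul_of_re_eq_zero hx hy'
    rw [ho'] at this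
    exact eq_neg_of_add_eq_zero_right (by simpa using this)
  by_cases h1 : y' + y = 0
  · refine ⟨x, hx0, rfl, ?_⟩
    rw [eq_neg_of_add_eq_zero_left h1, neg_mul, a1, neg_neg]
  · refine ⟨(y' + y) * y, fun h0 => hy0 (eq_zero_of_mul_mul_eq ha hb h0 h1), ?_, ?_⟩
    · calc (y' + y) * y * x = (y' + y) * (y * x) := by noncomm_ring
        _ = -((y' * x + y * x) * y) := by
          nth_rewrite 1 [a1]
          noncomm_ring
        _ = x * ((y' + y) * y) := by rw [a1, a2]; noncomm_ring
    · have e : y * y = y' * y' := by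
        rw [mul_self_of_re_eq_zero hy, mul_self_of_re_eq_zero hy', h]
      calc (y' + y) * y * y = y' * (y * y) + (y * y) * y := by noncomm_ring
        _ = y' * (y * y) + y' * y' * y := by rw [e]
        _ = y' * ((y' + y) * y) := by noncomm_ring

theorem nrd_mul (x y : ℍ[ℚ, a, b]) : nrd (x * y) = nrd x * nrd y := by
  simp [nrd_eq]; ring

theorem re_mul_comm (x y : ℍ[ℚ, a, b]) : (x * y).re = (y * x).re := by
  simp; ring

theorem re_conj (c : (ℍ[ℚ, a, b])ˣ) (x : ℍ[ℚ, a, b]) :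
    ((c⁻¹ : (ℍ[ℚ, a, b])ˣ) * x * c : ℍ[ℚ, a, b]).re = x.re := by
  rw [re_mul_comm, ← mul_assoc, Units.mul_inv, one_mul]

theorem nrd_conj (c : (ℍ[ℚ, a, b])ˣ) (x : ℍ[ℚ, a, b]) :
    nrd ((c⁻¹ : (ℍ[ℚ, a, b])ˣ) * x * c : ℍ[ℚ, a, b]) = nrd x := by
  have h : nrd ((c⁻¹ : (ℍ[ℚ, a, b])ˣ) : ℍ[ℚ, a, b]) * nrd (c : ℍ[ℚ, a, b]) = 1 := by
    rw [← nrd_mul, Units.inv_mul]; simp [nrd_eq]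
  rw [nrd_mul, nrd_mul]
  linear_combination nrd x * h

theorem pairing_conj (c : (ℍ[ℚ, a, b])ˣ) (x y : ℍ[ℚ, a, b]) :
    pairing ((c⁻¹ : (ℍ[ℚ, a, b])ˣ) * x * c : ℍ[ℚ, a, b]) ((c⁻¹ : (ℍ[ℚ, a, b])ˣ) * y * c) =
      pairing x y := by
  have h := nrd_conj c (x + y)
  rw [mul_add, add_mul, nrd_add, nrd_add, nrd_conj, nrd_conj] at h
  linarith

theorem pairing_orthComponent (x y : ℍ[ℚ, a, b]) : pairing x (orthComponent x y) = 0 := by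
  simp [orthComponent, nrd_eq, pairing_eq]
  ring

theorem re_orthComponent {x y : ℍ[ℚ, a, b]} (hx : x.re = 0) (hy : y.re = 0) :
    (orthComponent x y).re = 0 := by
  simp [orthComponent, hx, hy]

/-- Skolem–Noether for two pairs of trace zero elements with the same Gram matrix. -/
theorem exists_unit_conj (ha : a < 0) (hb : b < 0) {x y x' y' : ℍ[ℚ, a, b]}
    (hx : x.re = 0) (hy : y.re = 0) (hx' : x'.re = 0) (hy' : y'.re = 0)
    (h₁ : nrd x' = nrd x) (h₂ : nrd y' = nrd y) (h : pairing x' y' = pairing x y)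
    (hN : 0 < nrd x * nrd y - pairing x y ^ 2) :
    ∃ c : (ℍ[ℚ, a, b])ˣ, (c : ℍ[ℚ, a, b]) * x = x' * c ∧ (c : ℍ[ℚ, a, b]) * y = y' * c := by
  have hx0 : x ≠ 0 := by
    rintro rfl
    simp [nrd_eq, pairing_eq] at hN
  have hn := nrd_pos ha hb hx0
  have hxy : x * y ≠ y * x := by
    intro hc
    have h1 := mul_add_mul_of_re_eq_zero hx hy
    have h2 : x * y = ((-pairing x y : ℚ) : ℍ[ℚ, a, b]) := by
      rw [← hc] at h1
      ext
      · have := congrArg QuaternionAlgebra.re h1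
        simp at this ⊢; linarith
      · have := congrArg QuaternionAlgebra.imI h1
        simp at this ⊢; linarith
      · have := congrArg QuaternionAlgebra.imJ h1
        simp at this ⊢; linarith
      · have := congrArg QuaternionAlgebra.imK h1
        simp at this ⊢; linarith
    have h3 := nrd_mul x y
    rw [h2] at h3
    have h4 : nrd ((-pairing x y : ℚ) : ℍ[ℚ, a, b]) = pairing x y ^ 2 := by simp [nrd_eq]
    rw [← h3, h4] at hN
    simp at hN
  obtain ⟨c₁, hc₁, hc₁x⟩ := exists_intertwining hx hx' h₁ y hxy
  obtain ⟨c₁, rfl⟩ := isUnit_of_ne_zero ha hb hc₁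
  set y₁ : ℍ[ℚ, a, b] := (c₁⁻¹ : (ℍ[ℚ, a, b])ˣ) * y' * c₁ with hy₁
  have hx₁ : (c₁⁻¹ : (ℍ[ℚ, a, b])ˣ) * x' * c₁ = x := by
    rw [mul_assoc, ← hc₁x, ← mul_assoc, Units.inv_mul, one_mul]
  have hc₁y : (c₁ : ℍ[ℚ, a, b]) * y₁ = y' * c₁ := by
    rw [hy₁, ← mul_assoc, ← mul_assoc, Units.mul_inv, one_mul]
  have hy₁re : y₁.re = 0 := by rw [hy₁, re_conj, hy']
  have hy₁n : nrd y₁ = nrd y := by rw [hy₁, nrd_conj, h₂]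
  have hy₁p : pairing x y₁ = pairing x y := by rw [← hx₁, hy₁, pairing_conj, h, hx₁]
  obtain ⟨c₂, hc₂, hc₂x, hc₂y⟩ := exists_intertwining_of_fixed ha hb (x := x)
    (y := orthComponent x y) (y' := orthComponent x y₁) hx0
    (fun h0 => by
      have h1 := nrd_orthComponent x y
      rw [h0] at h1
      have h2 : nrd (0 : ℍ[ℚ, a, b]) = 0 := by simp [nrd_eq]
      exact (mul_pos hn hN).ne (h2.symm.trans h1))
    hx (re_orthComponent hx hy) (re_orthComponent hx hy₁re)
    (by rw [nrd_orthComponent, nrd_orthComponent, hy₁n, hy₁p])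
    (pairing_orthComponent x y) (pairing_orthComponent x y₁)
  obtain ⟨c₂, rfl⟩ := isUnit_of_ne_zero ha hb hc₂
  have hc₂y' : (c₂ : ℍ[ℚ, a, b]) * y = y₁ * c₂ := by
    rw [orthComponent, orthComponent, hy₁p, mul_sub, sub_mul, mul_smul_comm, mul_smul_comm,
      smul_mul_assoc, smul_mul_assoc, hc₂x, sub_left_inj] at hc₂y
    exact smul_right_injective _ hn.ne' hc₂y
  refine ⟨c₁ * c₂, ?_, ?_⟩
  · rw [Units.val_mul, mul_assoc, hc₂x, ← mul_assoc, hc₁x, mul_assoc]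
  · rw [Units.val_mul, mul_assoc, hc₂y', ← mul_assoc, hc₁y, mul_assoc]

/-! ### Orders containing a pair of Gram determinant `4 p` -/

theorem IsOrder.exists_int_of_coe_mem {O : Subring ℍ[ℚ, a, b]} (hO : IsOrder O) {q : ℚ}
    (hq : (q : ℍ[ℚ, a, b]) ∈ O) : ∃ k : ℤ, q = k := by
  have hinj : Function.Injective (algebraMap ℚ ℍ[ℚ, a, b]) :=
      FaithfulSMul.algebraMap_injective _ _
  obtain ⟨m, hm⟩ := IsIntegrallyClosed.isIntegral_iff.1
    ((isIntegral_algebraMap_iff hinj).1 (hO.isIntegral hq))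
  exact ⟨m, by simpa using hm.symm⟩

/-- Polarization of the divisibility of Gram determinants by `p`. -/
theorem IsDivisionOver.dvd_gram_polar {p : ℕ} [Fact p.Prime] (hp : p ≠ 2)
    (hdiv : IsDivisionOver ℚ_[p] a b) {x y z : ℍ[ℚ, a, b]} (hx : x.re = 0) (hy : y.re = 0)
    (hz : z.re = 0) {nx ny nz sxy sxz syz : ℤ} (hnx : nrd x = nx) (hny : nrd y = ny)
    (hnz : nrd z = nz) (hxy : pairing x y = sxy) (hxz : pairing x z = sxz)
    (hyz : pairing y z = syz) : (p : ℤ) ∣ ny * sxz - sxy * syz := by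
  have h1 := hdiv.dvd_gram hp hy hx hny hnx (by rw [pairing_comm, hxy])
  have h2 := hdiv.dvd_gram hp hy hz hny hnz hyz
  have h3 := hdiv.dvd_gram hp hy (y := x + z) (by simp [hx, hz]) hny
    (n₂ := nx + nz + 2 * sxz) (s := sxy + syz)
    (by rw [nrd_add, hnx, hnz, hxz]; push_cast; ring)
    (by rw [pairing_add_right, pairing_comm y x, hxy, hyz]; push_cast; ring)
  have h4 : (p : ℤ) ∣ 2 * (ny * sxz - sxy * syz) := by
    have := (h3.sub h1).sub h2
    ring_nf at this ⊢
    exact this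
  have hcop : IsCoprime (p : ℤ) 2 := by
    have h := (Nat.coprime_primes (Fact.out : p.Prime) Nat.prime_two).2 hp
    exact_mod_cast Nat.isCoprime_iff_coprime.2 h
  exact hcop.dvd_of_dvd_mul_left h4

/-- The vector product of two trace zero elements, `x y` without its scalar part. -/
def cross (x y : ℍ[ℚ, a, b]) : ℍ[ℚ, a, b] := x * y + (pairing x y : ℍ[ℚ, a, b])

/-- Expansion of `z` in the basis `x`, `y`, `cross x y` of the trace zero elements. -/
theorem gram_smul_eq {x y z : ℍ[ℚ, a, b]} (hx : x.re = 0) (hy : y.re = 0) (hz : z.re = 0) :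
    (nrd x * nrd y - pairing x y ^ 2) • z =
      (nrd y * pairing x z - pairing x y * pairing y z) • x +
      (nrd x * pairing y z - pairing x y * pairing x z) • y +
      pairing z (cross x y) • cross x y := by
  ext <;> simp [nrd_eq, pairing_eq, cross, hx, hy, hz] <;> ring

/-- The Gram determinant of three trace zero elements is the square of their triple product. -/
theorem pairing_cross_sq {x y z : ℍ[ℚ, a, b]} (hx : x.re = 0) (hy : y.re = 0) (hz : z.re = 0) :
    pairing z (cross x y) ^ 2 =
      nrd z * (nrd x * nrd y - pairing x y ^ 2) -
      pairing x z * (nrd y * pairing x z - pairing x y * pairing y z) -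
      pairing y z * (nrd x * pairing y z - pairing x y * pairing x z) := by
  simp [nrd_eq, pairing_eq, cross, hx, hy, hz]
  ring

/-- Twice `u` minus its trace, the element of the Gross lattice given by `u`. -/
def gross (u : ℍ[ℚ, a, b]) : ℍ[ℚ, a, b] := 2 * u - (trd u : ℍ[ℚ, a, b])

theorem gross_re (u : ℍ[ℚ, a, b]) : (gross u).re = 0 := by
  simp [gross, trd_eq, two_mul]

theorem pairing_gross (u v : ℍ[ℚ, a, b]) :
    pairing (gross u) (gross v) = 4 * pairing u v - trd u * trd v := by
  simp [gross, pairing_eq, trd_eq, two_mul]; ring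

theorem nrd_gross (u : ℍ[ℚ, a, b]) : nrd (gross u) = 4 * nrd u - trd u ^ 2 := by
  rw [← pairing_self, pairing_gross, pairing_self]; ring

theorem pairing_gross_cross (u v w : ℍ[ℚ, a, b]) :
    pairing (gross w) (cross (gross u) (gross v)) =
      2 * (2 * (2 * pairing w (u * v)) - trd v * (2 * pairing w u) - trd u * (2 * pairing w v) +
        2 * pairing u v * trd w) := by
  simp [gross, cross, pairing_eq, trd_eq, two_mul]; ring

/-- If `u`, `v` lie in an order and the Gram determinant of the corresponding elements of the Gross
lattice is `4 p`, the order is spanned by `1, u, v, u v`. The coefficients of an element lie in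
`ℤ / p` because the dual basis lies in `(1 / p) ℤ[u, v]`; they lie in `ℤ` since `p` divides all
`2 × 2` minors of Gram matrices, hence also the triple product, whose square is a Gram
determinant. -/
theorem IsOrder.exists_int_coeffs {p : ℕ} [Fact p.Prime] (hp : p ≠ 2)
    (hdiv : IsDivisionOver ℚ_[p] a b) {O : Subring ℍ[ℚ, a, b]} (hO : IsOrder O)
    {u v : ℍ[ℚ, a, b]} (hu : u ∈ O) (hv : v ∈ O)
    (hN : nrd (gross u) * nrd (gross v) - pairing (gross u) (gross v) ^ 2 = 4 * p)
    {w : ℍ[ℚ, a, b]} (hw : w ∈ O) :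
    ∃ k₀ k₁ k₂ k₃ : ℤ, w = (k₀ : ℍ[ℚ, a, b]) + k₁ * u + k₂ * v + k₃ * (u * v) := by
  have hpp : Prime (p : ℤ) := Nat.prime_iff_prime_int.1 Fact.out
  have hcop : IsCoprime (p : ℤ) 2 := by
    have h := (Nat.coprime_primes (Fact.out : p.Prime) Nat.prime_two).2 hp
    exact_mod_cast Nat.isCoprime_iff_coprime.2 h
  obtain ⟨t₁, ht₁⟩ := hO.exists_int_trd hu
  obtain ⟨t₂, ht₂⟩ := hO.exists_int_trd hv
  obtain ⟨T, hT⟩ := hO.exists_int_trd hw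
  obtain ⟨n₁, hn₁⟩ := hO.exists_int_nrd hu
  obtain ⟨n₂, hn₂⟩ := hO.exists_int_nrd hv
  obtain ⟨n₃, hn₃⟩ := hO.exists_int_nrd hw
  obtain ⟨m, hm⟩ := hO.exists_int_two_mul_pairing hu hv
  obtain ⟨A, hA⟩ := hO.exists_int_two_mul_pairing hw hu
  obtain ⟨B, hB⟩ := hO.exists_int_two_mul_pairing hw hv
  obtain ⟨C, hC⟩ := hO.exists_int_two_mul_pairing hw (O.mul_mem hu hv)
  set x := gross u with hx
  set y := gross v with hy
  set z := gross w with hz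
  have hxr : x.re = 0 := gross_re u
  have hyr : y.re = 0 := gross_re v
  have hzr : z.re = 0 := gross_re w
  have hnx : nrd x = ((4 * n₁ - t₁ ^ 2 : ℤ) : ℚ) := by
    rw [hx, nrd_gross, hn₁, ht₁]; push_cast; ring
  have hny : nrd y = ((4 * n₂ - t₂ ^ 2 : ℤ) : ℚ) := by
    rw [hy, nrd_gross, hn₂, ht₂]; push_cast; ring
  have hnz : nrd z = ((4 * n₃ - T ^ 2 : ℤ) : ℚ) := by
    rw [hz, nrd_gross, hn₃, hT]; push_cast; ring
  have hxy : pairing x y = ((2 * m - t₁ * t₂ : ℤ) : ℚ) := by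
    rw [hx, hy, pairing_gross, ht₁, ht₂]; push_cast; linear_combination 2 * hm
  have hxz : pairing x z = ((2 * A - t₁ * T : ℤ) : ℚ) := by
    rw [hx, hz, pairing_gross, ht₁, hT, pairing_comm]; push_cast; linear_combination 2 * hA
  have hyz : pairing y z = ((2 * B - t₂ * T : ℤ) : ℚ) := by
    rw [hy, hz, pairing_gross, ht₂, hT, pairing_comm]; push_cast; linear_combination 2 * hB
  set k₃ : ℤ := 2 * C - t₂ * A - t₁ * B + m * T with hk₃
  set k₁ : ℤ := 2 * n₂ * A - n₂ * t₁ * T - m * B + t₁ * t₂ * B - t₂ * C with hk₁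
  set k₂ : ℤ := 2 * n₁ * B - n₁ * t₂ * T - m * A + t₁ * t₂ * A - t₁ * C with hk₂
  have hG : pairing z (cross x y) = 2 * k₃ := by
    rw [hz, hx, hy, pairing_gross_cross, hA, hB, hC, hm, ht₁, ht₂, hT, hk₃]; push_cast; ring
  have hE : nrd y * pairing x z - pairing x y * pairing y z = 4 * k₁ + 2 * t₂ * k₃ := by
    rw [hny, hxz, hxy, hyz, hk₁, hk₃]; push_cast; ring
  have hF : nrd x * pairing y z - pairing x y * pairing x z = 4 * k₂ + 2 * t₁ * k₃ := by
    rw [hnx, hxz, hxy, hyz, hk₂, hk₃]; push_cast; ring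
  have hEd : (p : ℤ) ∣ 4 * k₁ + 2 * t₂ * k₃ := by
    have h := hdiv.dvd_gram_polar hp hxr hyr hzr hnx hny hnz hxy hxz hyz
    rw [hny, hxz, hxy, hyz] at hE
    have hE' : (4 * n₂ - t₂ ^ 2) * (2 * A - t₁ * T) - (2 * m - t₁ * t₂) * (2 * B - t₂ * T) =
      4 * k₁ + 2 * t₂ * k₃ := by exact_mod_cast hE
    rwa [hE'] at h
  have hFd : (p : ℤ) ∣ 4 * k₂ + 2 * t₁ * k₃ := by
    have h := hdiv.dvd_gram_polar hp hyr hxr hzr hny hnx hnz (by rw [pairing_comm, hxy]) hyz hxz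
    rw [hnx, hxz, hxy, hyz] at hF
    have hF' : (4 * n₁ - t₁ ^ 2) * (2 * B - t₂ * T) - (2 * m - t₁ * t₂) * (2 * A - t₁ * T) =
      4 * k₂ + 2 * t₁ * k₃ := by exact_mod_cast hF
    rwa [hF'] at h
  have hk₃d : (p : ℤ) ∣ k₃ := by
    have h := pairing_cross_sq hxr hyr hzr
    rw [hE, hF, hN, hG, hnz, hxz, hyz] at h
    have h' : (2 * k₃) ^ 2 = (4 * n₃ - T ^ 2) * (4 * p) - (2 * A - t₁ * T) *
      (4 * k₁ + 2 * t₂ * k₃) - (2 * B - t₂ * T) * (4 * k₂ + 2 * t₁ * k₃) := by exact_mod_cast h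
    have hd : (p : ℤ) ∣ (2 * k₃) ^ 2 := by
      rw [h']
      refine ((Dvd.intro_left ((4 * n₃ - T ^ 2) * 4) (by ring)).sub ?_).sub ?_
      · exact hEd.mul_left _
      · exact hFd.mul_left _
    exact hcop.dvd_of_dvd_mul_left (hpp.dvd_of_dvd_pow hd)
  have hk₁d : (p : ℤ) ∣ k₁ := by
    have h : (p : ℤ) ∣ 2 * (2 * k₁) := by
      have := hEd.sub (hk₃d.mul_left (2 * t₂))
      ring_nf at this ⊢
      exact this
    exact hcop.dvd_of_dvd_mul_left (hcop.dvd_of_dvd_mul_left h)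
  have hk₂d : (p : ℤ) ∣ k₂ := by
    have h : (p : ℤ) ∣ 2 * (2 * k₂) := by
      have := hFd.sub (hk₃d.mul_left (2 * t₁))
      ring_nf at this ⊢
      exact this
    exact hcop.dvd_of_dvd_mul_left (hcop.dvd_of_dvd_mul_left h)
  clear_value k₁ k₂ k₃
  obtain ⟨l₁, rfl⟩ := hk₁d
  obtain ⟨l₂, rfl⟩ := hk₂d
  obtain ⟨l₃, rfl⟩ := hk₃d
  have hp0 : (p : ℚ) ≠ 0 := by exact_mod_cast (Fact.out : p.Prime).ne_zero
  have hexp := gram_smul_eq hxr hyr hzr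
  rw [hE, hF, hG, hN] at hexp
  -- By the expansion of `gross w`, this remainder has no imaginary part.
  set d := w - (l₁ * u + l₂ * v + l₃ * (u * v)) with hd
  have hdO : d ∈ O := by
    refine O.sub_mem hw (O.add_mem (O.add_mem ?_ ?_) ?_)
    · exact O.mul_mem (intCast_mem O _) hu
    · exact O.mul_mem (intCast_mem O _) hv
    · exact O.mul_mem (intCast_mem O _) (O.mul_mem hu hv)
  rw [trd_eq] at ht₁ ht₂
  have hdre : d = (d.re : ℍ[ℚ, a, b]) := by
    have h8 : (8 * (p : ℚ)) ≠ 0 := mul_ne_zero (by norm_num) hp0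
    ext
    · simp
    · have h := congrArg QuaternionAlgebra.imI hexp
      simp [hx, hy, hz, gross, cross, two_mul, ← ht₁, ← ht₂, trd_eq] at h
      simp [hd]
      apply mul_left_cancel₀ h8
      linear_combination h
    · have h := congrArg QuaternionAlgebra.imJ hexp
      simp [hx, hy, hz, gross, cross, two_mul, ← ht₁, ← ht₂, trd_eq] at h
      simp [hd]
      apply mul_left_cancel₀ h8
      linear_combination h
    · have h := congrArg QuaternionAlgebra.imK hexp
      simp [hx, hy, hz, gross, cross, two_mul, ← ht₁, ← ht₂, trd_eq] at h
      simp [hd]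
      apply mul_left_cancel₀ h8
      linear_combination h
  rw [hdre] at hdO
  obtain ⟨l₀, hl₀⟩ := hO.exists_int_of_coe_mem hdO
  refine ⟨l₀, l₁, l₂, l₃, ?_⟩
  have : (l₀ : ℍ[ℚ, a, b]) = d := by
    rw [hdre, hl₀]; ext <;> simp
  rw [this, hd]
  abel

/-! ### Gram matrices in Gross lattices -/

theorem re_of_mem_grossLattice {O : Subring ℍ[ℚ, a, b]} {x : ℍ[ℚ, a, b]}
    (hx : x ∈ grossLattice O) : x.re = 0 := by
  obtain ⟨u, -, rfl⟩ := hx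
  exact gross_re u

theorem IsOrder.exists_int_nrd_of_mem_grossLattice {O : Subring ℍ[ℚ, a, b]} (hO : IsOrder O)
    {x : ℍ[ℚ, a, b]} (hx : x ∈ grossLattice O) : ∃ n : ℤ, nrd x = n := by
  obtain ⟨u, hu, rfl⟩ := hx
  obtain ⟨t, ht⟩ := hO.exists_int_trd hu
  obtain ⟨n, hn⟩ := hO.exists_int_nrd hu
  refine ⟨4 * n - t ^ 2, ?_⟩
  have := nrd_gross u
  rw [ht, hn] at this
  push_cast
  exact this

theorem IsOrder.exists_int_pairing_of_mem_grossLattice {O : Subring ℍ[ℚ, a, b]} (hO : IsOrder O)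
    {x y : ℍ[ℚ, a, b]} (hx : x ∈ grossLattice O) (hy : y ∈ grossLattice O) :
    ∃ s : ℤ, pairing x y = s := by
  obtain ⟨u, hu, rfl⟩ := hx
  obtain ⟨v, hv, rfl⟩ := hy
  obtain ⟨t₁, ht₁⟩ := hO.exists_int_trd hu
  obtain ⟨t₂, ht₂⟩ := hO.exists_int_trd hv
  obtain ⟨m, hm⟩ := hO.exists_int_two_mul_pairing hu hv
  refine ⟨2 * m - t₁ * t₂, ?_⟩
  have h := pairing_gross u v
  rw [ht₁, ht₂] at h
  push_cast
  rw [← hm]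
  refine h.trans ?_
  ring

theorem IsOrder.exists_gram_eq_four_mul {p : ℕ} [Fact p.Prime] (hp : p ≠ 2)
    (hdiv : IsDivisionOver ℚ_[p] a b) {O : Subring ℍ[ℚ, a, b]} (hO : IsOrder O)
    {x y : ℍ[ℚ, a, b]} (hx : x ∈ grossLattice O) (hy : y ∈ grossLattice O) :
    ∃ k : ℤ, nrd x * nrd y - pairing x y ^ 2 = 4 * p * k := by
  obtain ⟨n₁, h₁⟩ := hO.exists_int_nrd_of_mem_grossLattice hx
  obtain ⟨n₂, h₂⟩ := hO.exists_int_nrd_of_mem_grossLattice hy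
  obtain ⟨s, hs⟩ := hO.exists_int_pairing_of_mem_grossLattice hx hy
  have hpd := hdiv.dvd_gram hp (re_of_mem_grossLattice hx) (re_of_mem_grossLattice hy) h₁ h₂ hs
  have h4d : (4 : ℤ) ∣ n₁ * n₂ - s ^ 2 := by
    obtain ⟨u, hu, rfl⟩ := hx
    obtain ⟨v, hv, rfl⟩ := hy
    obtain ⟨t₁, ht₁⟩ := hO.exists_int_trd hu
    obtain ⟨t₂, ht₂⟩ := hO.exists_int_trd hv
    obtain ⟨m₁, hm₁⟩ := hO.exists_int_nrd hu
    obtain ⟨m₂, hm₂⟩ := hO.exists_int_nrd hv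
    obtain ⟨m, hm⟩ := hO.exists_int_two_mul_pairing hu hv
    have e₁ := (nrd_gross u).symm.trans h₁
    have e₂ := (nrd_gross v).symm.trans h₂
    have e := (pairing_gross u v).symm.trans hs
    rw [ht₁, hm₁] at e₁
    rw [ht₂, hm₂] at e₂
    rw [ht₁, ht₂, show 4 * pairing u v = 2 * (2 * pairing u v) by ring, hm] at e
    have e₁ : n₁ = 4 * m₁ - t₁ ^ 2 := by exact_mod_cast e₁.symm
    have e₂ : n₂ = 4 * m₂ - t₂ ^ 2 := by exact_mod_cast e₂.symm
    have e : s = 2 * m - t₁ * t₂ := by exact_mod_cast e.symm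
    refine ⟨4 * m₁ * m₂ - m₁ * t₂ ^ 2 - m₂ * t₁ ^ 2 - m ^ 2 + m * t₁ * t₂, ?_⟩
    rw [e₁, e₂, e]
    ring
  have hcop : IsCoprime (4 : ℤ) p := by
    have h := (Nat.coprime_primes Nat.prime_two (Fact.out : p.Prime)).2 hp.symm
    have h2 : Nat.Coprime (2 ^ 2) p := h.pow_left 2
    exact_mod_cast Nat.isCoprime_iff_coprime.2 h2
  obtain ⟨k, hk⟩ := hcop.mul_dvd h4d hpd
  refine ⟨k, ?_⟩
  rw [h₁, h₂, hs]
  exact_mod_cast hk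

theorem nrd_eq_of_isPrimitive_of_smul_eq {L : AddSubgroup ℍ[ℚ, a, b]} {x y : ℍ[ℚ, a, b]}
    (hx : IsPrimitive L x) (hy : IsPrimitive L y) {n s : ℤ} (hn : n ≠ 0)
    (h : (n : ℚ) • y = (s : ℚ) • x) : nrd y = nrd x := by
  obtain ⟨g, n', s', hg, hgcd, hn', hs'⟩ :=
    Int.exists_gcd_one' (Int.gcd_pos_of_ne_zero_left s hn)
  have hg0 : (g : ℚ) ≠ 0 := by exact_mod_cast hg.ne'
  have h' : (n' : ℚ) • y = (s' : ℚ) • x := by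
    apply smul_right_injective _ hg0
    simp only [smul_smul]
    rw [hn', hs'] at h
    push_cast at h
    rwa [mul_comm (g : ℚ), mul_comm (g : ℚ)]
  obtain ⟨α, β, hαβ⟩ := Int.isCoprime_iff_gcd_eq_one.2 hgcd
  have hαβ' : (α : ℚ) * n' + β * s' = 1 := by exact_mod_cast hαβ
  -- Both vectors are multiples of `α x + β y`.
  have hw : α • x + β • y ∈ L := L.add_mem (L.zsmul_mem hx.1 _) (L.zsmul_mem hy.1 _)
  have e1 : n' • (α • x + β • y) = x := by
    simp only [← Int.cast_smul_eq_zsmul ℚ, smul_add]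
    rw [smul_comm (n' : ℚ) (β : ℚ) y, h', smul_smul, smul_smul, ← add_smul, mul_comm (n' : ℚ),
      hαβ', one_smul]
  have e2 : s' • (α • x + β • y) = y := by
    simp only [← Int.cast_smul_eq_zsmul ℚ, smul_add]
    rw [smul_comm (s' : ℚ) (α : ℚ) x, ← h', smul_smul, smul_smul, ← add_smul, mul_comm (s' : ℚ),
      hαβ', one_smul]
  have key : ∀ m : ℤ, (m = 1 ∨ m = -1) → ∀ w : ℍ[ℚ, a, b], nrd (m • w) = nrd w := by
    rintro m (rfl | rfl) w
    · rw [one_smul]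
    · rw [neg_smul, one_smul, nrd_neg]
  have k1 := key n' (hx.2.2 _ hw _ e1) (α • x + β • y)
  have k2 := key s' (hy.2.2 _ hw _ e2) (α • x + β • y)
  rw [e1] at k1
  rw [e2] at k2
  rw [k1, k2]

/-- Two primitive elements of a Gross lattice either have the same norm and are proportional, or
their Gram determinant is a positive multiple of `4 p`. -/
theorem IsOrder.gram_of_isPrimitive (ha : a < 0) (hb : b < 0) {p : ℕ} [Fact p.Prime] (hp : p ≠ 2)
    (hdiv : IsDivisionOver ℚ_[p] a b) {O : Subring ℍ[ℚ, a, b]} (hO : IsOrder O)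
    {x y : ℍ[ℚ, a, b]} (hx : IsPrimitive (grossLattice O) x)
    (hy : IsPrimitive (grossLattice O) y) :
    nrd y = nrd x ∨
      ∃ k : ℤ, 1 ≤ k ∧ nrd x * nrd y - pairing x y ^ 2 = 4 * p * k := by
  obtain ⟨k, hk⟩ := hO.exists_gram_eq_four_mul hp hdiv hx.1 hy.1
  rcases gram_pos_or_proportional ha hb x y hx.2.1 with h | h
  · right
    refine ⟨k, ?_, hk⟩
    rw [hk] at h
    have : (0 : ℚ) < k := pos_of_mul_pos_right h (by positivity)
    exact_mod_cast this
  · left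
    obtain ⟨n, hn⟩ := hO.exists_int_nrd_of_mem_grossLattice hx.1
    obtain ⟨s, hs⟩ := hO.exists_int_pairing_of_mem_grossLattice hx.1 hy.1
    have hn0 := (nrd_pos ha hb hx.2.1).ne'
    rw [hn, hs] at h
    rw [hn] at hn0
    exact nrd_eq_of_isPrimitive_of_smul_eq hx hy (by exact_mod_cast hn0) h

/-! ### Conjugacy of the orders -/

/-- Elements of equal norm in two Gross lattices lift to elements of equal trace: the norm of
`2 u - Tr u` determines the parity of `Tr u`, and adding an integer to `u` shifts the trace by an
even number. -/
theorem exists_lift_trd_eq {O O' : Subring ℍ[ℚ, a, b]} (hO : IsOrder O) (hO' : IsOrder O')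
    {u x' : ℍ[ℚ, a, b]} (hu : u ∈ O) (hx' : x' ∈ grossLattice O') (h : nrd x' = nrd (gross u)) :
    ∃ u' ∈ O', gross u' = x' ∧ trd u' = trd u := by
  obtain ⟨u', hu', rfl⟩ := hx'
  obtain ⟨t, ht⟩ := hO.exists_int_trd hu
  obtain ⟨t', ht'⟩ := hO'.exists_int_trd hu'
  obtain ⟨n, hn⟩ := hO.exists_int_nrd hu
  obtain ⟨n', hn'⟩ := hO'.exists_int_nrd hu'
  have e := (nrd_gross u').symm.trans h
  rw [nrd_gross, ht, ht', hn, hn'] at e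
  have e' : 4 * n' - t' ^ 2 = 4 * n - t ^ 2 := by exact_mod_cast e
  have hpar : Even (t' - t) := by
    have h2 : Even (t' ^ 2 - t ^ 2) := ⟨2 * n' - 2 * n, by linarith⟩
    simpa [Int.even_sub, Int.even_pow] using h2
  obtain ⟨e, he⟩ := hpar
  have heQ : (t' : ℚ) = t + 2 * e := by
    have : t' = t + 2 * e := by linarith
    exact_mod_cast this
  rw [trd_eq] at ht ht'
  refine ⟨u' - e, O'.sub_mem hu' (intCast_mem O' e), ?_, ?_⟩
  · ext <;> simp [gross, trd_eq, two_mul]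
  · rw [trd_eq, trd_eq]
    simp
    linarith

theorem mul_eq_mul_of_gross {c u u' : ℍ[ℚ, a, b]} (h : c * gross u = gross u' * c)
    (ht : trd u' = trd u) : c * u = u' * c := by
  have h2 : (2 : ℚ) • (c * u) = (2 : ℚ) • (u' * c) := by
    rw [gross, gross, mul_sub, sub_mul, ht,
      ← (QuaternionAlgebra.coe_commutes (trd u) c), sub_left_inj] at h
    simp only [two_mul, mul_add, add_mul] at h
    rw [two_smul, two_smul, h]
  exact smul_right_injective _ two_ne_zero h2

/-- Orders whose Gross lattices contain isometric pairs of Gram determinant `4 p` are conjugate. -/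
theorem sameType_of_gram_eq (ha : a < 0) (hb : b < 0) {p : ℕ} [Fact p.Prime] (hp : p ≠ 2)
    (hdiv : IsDivisionOver ℚ_[p] a b) {O O' : Subring ℍ[ℚ, a, b]} (hO : IsOrder O)
    (hO' : IsOrder O') {x y x' y' : ℍ[ℚ, a, b]} (hx : x ∈ grossLattice O)
    (hy : y ∈ grossLattice O) (hx' : x' ∈ grossLattice O') (hy' : y' ∈ grossLattice O')
    (h₁ : nrd x' = nrd x) (h₂ : nrd y' = nrd y) (h : pairing x' y' = pairing x y)
    (hN : nrd x * nrd y - pairing x y ^ 2 = 4 * p) : SameType O O' := by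
  have hp0 : (0 : ℚ) < p := by exact_mod_cast (Fact.out : p.Prime).pos
  obtain ⟨c, hcx, hcy⟩ := exists_unit_conj ha hb (re_of_mem_grossLattice hx)
    (re_of_mem_grossLattice hy) (re_of_mem_grossLattice hx') (re_of_mem_grossLattice hy')
    h₁ h₂ h (by rw [hN]; positivity)
  obtain ⟨u, hu, rfl⟩ := hx
  obtain ⟨v, hv, rfl⟩ := hy
  obtain ⟨u', hu', rfl, htu⟩ := exists_lift_trd_eq hO hO' hu hx' h₁
  obtain ⟨v', hv', rfl, htv⟩ := exists_lift_trd_eq hO hO' hv hy' h₂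
  have hcu := mul_eq_mul_of_gross hcx htu
  have hcv := mul_eq_mul_of_gross hcy htv
  have hcomb : ∀ k₀ k₁ k₂ k₃ : ℤ,
      (c : ℍ[ℚ, a, b]) * ((k₀ : ℍ[ℚ, a, b]) + k₁ * u + k₂ * v + k₃ * (u * v)) =
        ((k₀ : ℍ[ℚ, a, b]) + k₁ * u' + k₂ * v' + k₃ * (u' * v')) * c := by
    intro k₀ k₁ k₂ k₃
    have hk : ∀ (k : ℤ) (q : ℍ[ℚ, a, b]), (c : ℍ[ℚ, a, b]) * (k * q) = k * (c * q) := by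
      intro k q
      rw [← mul_assoc, ← (Int.cast_commute k (c : ℍ[ℚ, a, b])).eq, mul_assoc]
    have huv : (c : ℍ[ℚ, a, b]) * (u * v) = u' * v' * c := by
      rw [← mul_assoc, hcu, mul_assoc, hcv, mul_assoc]
    rw [mul_add, mul_add, mul_add, hk, hk, hk, hcu, hcv, huv,
      ← (Int.cast_commute k₀ (c : ℍ[ℚ, a, b])).eq]
    simp only [add_mul, mul_assoc]
  have hmem : ∀ (R : Subring ℍ[ℚ, a, b]) {q r : ℍ[ℚ, a, b]}, q ∈ R → r ∈ R →
      ∀ k₀ k₁ k₂ k₃ : ℤ, (k₀ : ℍ[ℚ, a, b]) + k₁ * q + k₂ * r + k₃ * (q * r) ∈ R := by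
    intro R q r hq hr k₀ k₁ k₂ k₃
    exact R.add_mem (R.add_mem (R.add_mem (intCast_mem R _) (R.mul_mem (intCast_mem R _) hq))
      (R.mul_mem (intCast_mem R _) hr)) (R.mul_mem (intCast_mem R _) (R.mul_mem hq hr))
  refine ⟨c, Set.Subset.antisymm ?_ ?_⟩
  · rintro _ ⟨w, hw, rfl⟩
    obtain ⟨k₀, k₁, k₂, k₃, rfl⟩ := hO.exists_int_coeffs hp hdiv hu hv hN hw
    simp only [hcomb, mul_assoc _ (c : ℍ[ℚ, a, b]), Units.mul_inv, mul_one]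
    exact hmem O' hu' hv' _ _ _ _
  · intro w hw
    obtain ⟨k₀, k₁, k₂, k₃, rfl⟩ := hO'.exists_int_coeffs hp hdiv hu' hv'
      (by rw [h₁, h₂, h]; exact hN) hw
    refine ⟨_, hmem O hu hv k₀ k₁ k₂ k₃, ?_⟩
    simp only [hcomb, mul_assoc _ (c : ℍ[ℚ, a, b]), Units.mul_inv, mul_one]

theorem sameType_of_gram_sq_eq (ha : a < 0) (hb : b < 0) {p : ℕ} [Fact p.Prime] (hp : p ≠ 2)
    (hdiv : IsDivisionOver ℚ_[p] a b) {O O' : Subring ℍ[ℚ, a, b]} (hO : IsOrder O)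
    (hO' : IsOrder O') {x y x' y' : ℍ[ℚ, a, b]} (hx : x ∈ grossLattice O)
    (hy : y ∈ grossLattice O) (hx' : x' ∈ grossLattice O') (hy' : y' ∈ grossLattice O')
    (h₁ : nrd x' = nrd x) (h₂ : nrd y' = nrd y) (h : pairing x' y' ^ 2 = pairing x y ^ 2)
    (hN : nrd x * nrd y - pairing x y ^ 2 = 4 * p) : SameType O O' := by
  rcases sq_eq_sq_iff_eq_or_eq_neg.1 h with h | h
  · exact sameType_of_gram_eq ha hb hp hdiv hO hO' hx hy hx' hy' h₁ h₂ h hN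
  · exact sameType_of_gram_eq ha hb hp hdiv hO hO' hx hy hx' (neg_mem hy') h₁
      (by rw [nrd_neg, h₂]) (by rw [pairing_neg_right, h, neg_neg]) hN

/-! ### The case of equal minima -/

theorem mul_sq_ne_mul_prime {p : ℕ} (hp : p.Prime) {c d D : ℤ} (hc : 0 < c) (hcp : c < p)
    (hd : 0 < d) (hdp : d < p) : c * D ^ 2 ≠ d * p := by
  intro h
  have hpp : Prime (p : ℤ) := Nat.prime_iff_prime_int.1 hp
  have hD : (p : ℤ) ∣ D := by
    have h1 : (p : ℤ) ∣ c * D ^ 2 := Dvd.intro_left _ h.symm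
    rcases hpp.dvd_or_dvd h1 with h2 | h2
    · exact absurd (Int.le_of_dvd hc h2) (not_le.2 hcp)
    · exact hpp.dvd_of_dvd_pow h2
  obtain ⟨e, rfl⟩ := hD
  have h2 : d = p * (c * e ^ 2) := by
    apply mul_right_cancel₀ hpp.ne_zero
    rw [← h]; ring
  exact absurd (Int.le_of_dvd hd (Dvd.intro _ h2.symm)) (not_le.2 hdp)

/-- The case `nrd x = nrd y = D`, where elements of norm `D` in the second lattice may all be
proportional. Instead of `y`, the vector `x - y` of norm `2 D - 2 s`, with `s = ⟨x, y⟩`, is matched: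
for Gram determinant `0` this requires `D = 2 s`, so `3 D ^ 2 = 16 p`; for `8 p` it requires
`⟨x', w'⟩ ^ 2 = 2 s (s - D)`, so `s = 0` and `D ^ 2 = 4 p`. Neither has a solution. -/
theorem sameType_of_nrd_eq_nrd (ha : a < 0) (hb : b < 0) {p : ℕ} [Fact p.Prime] (hp : 16 < p)
    (hdiv : IsDivisionOver ℚ_[p] a b) {O O' : Subring ℍ[ℚ, a, b]} (hO : IsOrder O)
    (hO' : IsOrder O') {x y x' w' : ℍ[ℚ, a, b]} (hx : x ∈ grossLattice O)
    (hy : y ∈ grossLattice O) (hx' : IsPrimitive (grossLattice O') x')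
    (hw' : IsPrimitive (grossLattice O') w') (h₁ : nrd x' = nrd x) (hxy : nrd y = nrd x)
    (hw : nrd w' = nrd (x - y)) (hs : 0 ≤ pairing x y) (hred : nrd x ≤ nrd (x - y))
    (hD : 0 < nrd x) (hN : nrd x * nrd y - pairing x y ^ 2 = 4 * p)
    (hlt : nrd x * nrd y < 16 / 3 * p) : SameType O O' := by
  have hprime : p.Prime := Fact.out
  obtain ⟨n, hn⟩ := hO.exists_int_nrd_of_mem_grossLattice hx
  have hp16 : (16 : ℤ) < p := by exact_mod_cast hp
  rw [hxy] at hN hlt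
  have hwn : nrd (x - y) = 2 * nrd x - 2 * pairing x y := by rw [nrd_sub, hxy]; ring
  have hxw : pairing x (x - y) = nrd x - pairing x y := by rw [pairing_sub_right, pairing_self]
  have hp0 : (0 : ℚ) < p := by exact_mod_cast hprime.pos
  rcases hO'.gram_of_isPrimitive ha hb (by omega : p ≠ 2) hdiv hx' hw' with h | ⟨k, hk1, hk⟩
  · exfalso
    rw [hw, h₁, hwn] at h
    have h3 : 3 * nrd x ^ 2 = 16 * p := by
      have : pairing x y = nrd x / 2 := by linarith
      rw [this] at hN
      linarith
    rw [hn] at h3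
    exact mul_sq_ne_mul_prime hprime (by norm_num : (0 : ℤ) < 3) (by omega)
      (by norm_num : (0 : ℤ) < 16) hp16 (D := n) (by exact_mod_cast h3)
  · rw [h₁, hw, hwn] at hk
    have hk3 : (k : ℚ) < 3 := by
      have h1 : 4 * (p : ℚ) * k < 4 * p * 3 := by
        nlinarith [sq_nonneg (pairing x' w'), mul_nonneg hD.le hs]
      exact lt_of_mul_lt_mul_left h1 (by positivity)
    have hk3' : k < 3 := by exact_mod_cast hk3
    have hk12 : k = 1 ∨ k = 2 := by omega
    rcases hk12 with rfl | rfl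
    · refine sameType_of_gram_sq_eq ha hb (by omega : p ≠ 2) hdiv hO hO' hx
        (sub_mem hx hy) hx'.1 hw'.1 h₁ hw ?_ ?_
      · rw [hxw]
        push_cast at hk
        linear_combination hN - hk
      · rw [hxw, hwn]
        linear_combination hN
    · exfalso
      push_cast at hk
      have ht : pairing x' w' ^ 2 = 2 * pairing x y * (pairing x y - nrd x) := by
        linear_combination 2 * hN - hk
      have hs0 : pairing x y = 0 := by
        by_contra hne
        have hpos : 0 < pairing x y := lt_of_le_of_ne hs (Ne.symm hne)
        have : 0 < 2 * pairing x y * (nrd x - pairing x y) :=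
          mul_pos (by linarith) (by linarith)
        nlinarith [sq_nonneg (pairing x' w')]
      rw [hs0, hn] at hN
      exact mul_sq_ne_mul_prime hprime (by norm_num : (0 : ℤ) < 1) (by omega)
        (by norm_num : (0 : ℤ) < 4) (by omega) (D := n) (by
          have : (1 : ℚ) * (n : ℚ) ^ 2 = 4 * p := by linear_combination hN
          exact_mod_cast this)

theorem le_nrd_of_isSuccessiveMinimum_one {L : AddSubgroup ℍ[ℚ, a, b]} {D : ℚ}
    (hD : IsSuccessiveMinimum L 1 D) {v : ℍ[ℚ, a, b]} (hv : v ∈ L) (hv0 : v ≠ 0) : D ≤ nrd v :=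
  hD.2 ⟨fun _ => v, LinearIndependent.of_subsingleton 0 hv0, fun _ => ⟨hv, le_rfl⟩⟩

end QuatOrder

/-! ### Recovering the order -/

theorem theorem1 (p : ℕ) (hp : p.Prime) (a b : ℚ)
    (hB : QuatOrder.IsRamifiedExactlyAt p a b)
    (O O' : Subring ℍ[ℚ, a, b])
    (hO : QuatOrder.IsMaximalOrder O) (hO' : QuatOrder.IsMaximalOrder O')
    (D₁ D₂ D₃ : ℚ)
    (hD₁ : QuatOrder.IsSuccessiveMinimum (QuatOrder.grossLattice O) 1 D₁)
    (hD₂ : QuatOrder.IsSuccessiveMinimum (QuatOrder.grossLattice O) 2 D₂)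
    (hD₃ : QuatOrder.IsSuccessiveMinimum (QuatOrder.grossLattice O) 3 D₃)
    (x y z : ℍ[ℚ, a, b])
    (hx : x ∈ QuatOrder.grossLattice O) (hy : y ∈ QuatOrder.grossLattice O)
    (hz : z ∈ QuatOrder.grossLattice O)
    (hxyz : LinearIndependent ℚ ![x, y, z])
    (hxD : QuatOrder.nrd x = D₁) (hyD : QuatOrder.nrd y = D₂) (hzD : QuatOrder.nrd z = D₃)
    (h₁ : QuatOrder.OptimallyRepresents (QuatOrder.grossLattice O') D₁)
    (h₂ : QuatOrder.OptimallyRepresents (QuatOrder.grossLattice O') D₂)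
    (hadd : QuatOrder.OptimallyRepresents (QuatOrder.grossLattice O') (QuatOrder.nrd (x + y)))
    (hsub : QuatOrder.OptimallyRepresents (QuatOrder.grossLattice O') (QuatOrder.nrd (x - y)))
    (h₃ : QuatOrder.OptimallyRepresents (QuatOrder.grossLattice O') D₃)
    (hmult : QuatOrder.optimalMultiplicity (QuatOrder.grossLattice O) D₃ ≤
      QuatOrder.optimalMultiplicity (QuatOrder.grossLattice O') D₃)
    (hD₁D₂ : D₁ * D₂ < 16 / 3 * (p : ℚ)) (hD₁_ge : 15 ≤ D₁) (hp_gt : 286 < p) :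
    QuatOrder.SameType O O' := by
  open QuatOrder in
  have : Fact p.Prime := ⟨hp⟩
  obtain ⟨ha, hb⟩ := hB.infinite_place.neg_of_real
  have hdiv : IsDivisionOver ℚ_[p] a b := (hB.finite_places p).2 rfl
  have hp2 : p ≠ 2 := by omega
  have hOo : IsOrder O := hO.prop
  have hOo' : IsOrder O' := hO'.prop
  have hind : ∀ s t : ℚ, s • x + t • y = 0 → s = 0 ∧ t = 0 := by
    have h := hxyz.comp ![0, 1] (by decide)
    have h2 : (![x, y, z] ∘ ![0, 1] : Fin 2 → ℍ[ℚ, a, b]) = ![x, y] := by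
      ext i : 1; fin_cases i <;> rfl
    rw [h2] at h
    exact LinearIndependent.pair_iff.1 h
  have hx0 : x ≠ 0 := by
    rintro rfl
    exact one_ne_zero (hind 1 0 (by simp)).1
  have hxpos : 0 < nrd x := nrd_pos ha hb hx0
  have hp0 : (0 : ℚ) < p := by exact_mod_cast hp.pos
  rw [← hxD, ← hyD] at hD₁D₂
  have hN : nrd x * nrd y - pairing x y ^ 2 = 4 * p := by
    obtain ⟨k, hk⟩ := hOo.exists_gram_eq_four_mul hp2 hdiv hx hy
    have hpos : 0 < nrd x * nrd y - pairing x y ^ 2 := by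
      rcases gram_pos_or_proportional ha hb x y hx0 with h | h
      · exact h
      · have := (hind (-pairing x y) (nrd x) (by rw [h]; module)).2
        exact absurd this hxpos.ne'
    have hk0 : (0 : ℚ) < k := by
      rw [hk] at hpos
      exact pos_of_mul_pos_right hpos (by positivity)
    have hk2 : (k : ℚ) < 2 := by
      have h1 : 4 * (p : ℚ) * k < 4 * p * 2 := by
        nlinarith [sq_nonneg (pairing x y)]
      exact lt_of_mul_lt_mul_left h1 (by positivity)
    have hk1 : k = 1 := by
      have h1 : 0 < k := by exact_mod_cast hk0
      have h2 : k < 2 := by exact_mod_cast hk2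
      omega
    rw [hk, hk1]; push_cast; ring
  obtain ⟨x', hx', hx'D⟩ := h₁
  obtain ⟨y', hy', hy'D⟩ := h₂
  rw [← hxD] at hx'D
  rw [← hyD] at hy'D
  rcases hOo'.gram_of_isPrimitive ha hb hp2 hdiv hx' hy' with h | ⟨k, hk1, hk⟩
  · rw [hx'D, hy'D] at h
    have hred : ∀ v ∈ grossLattice O, v ≠ 0 → nrd x ≤ nrd v := fun v hv hv0 => by
      rw [hxD]
      exact le_nrd_of_isSuccessiveMinimum_one hD₁ hv hv0
    -- The sign of `⟨x, y⟩` decides which of `x - y` and `x + y` is the shorter one.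
    rcases le_total 0 (pairing x y) with hs | hs
    · obtain ⟨w', hw', hw'D⟩ := hsub
      refine sameType_of_nrd_eq_nrd ha hb (by omega) hdiv hOo hOo' hx hy hx' hw' hx'D h hw'D hs
        (hred _ (sub_mem hx hy) fun h0 => ?_) hxpos hN hD₁D₂
      exact one_ne_zero (hind 1 (-1) (by rw [← h0]; module)).1
    · obtain ⟨w', hw', hw'D⟩ := hadd
      refine sameType_of_nrd_eq_nrd ha hb (by omega) hdiv hOo hOo' hx (neg_mem hy) hx' hw' hx'D
        (by rw [nrd_neg, h]) (by rw [hw'D, sub_neg_eq_add]) (by rw [pairing_neg_right]; linarith)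
        (hred _ (sub_mem hx (neg_mem hy)) fun h0 => ?_) hxpos
        (by rw [nrd_neg, pairing_neg_right, neg_sq, hN]) (by rwa [nrd_neg])
      exact one_ne_zero (hind 1 1 (by rw [← h0]; module)).1
  · rw [hx'D, hy'D] at hk
    have hk2 : (k : ℚ) < 2 := by
      have h1 : 4 * (p : ℚ) * k < 4 * p * 2 := by
        nlinarith [sq_nonneg (pairing x' y')]
      exact lt_of_mul_lt_mul_left h1 (by positivity)
    have hk1' : k = 1 := by
      have h2 : k < 2 := by exact_mod_cast hk2
      omega
    subst hk1'
    push_cast at hk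
    exact sameType_of_gram_sq_eq ha hb hp2 hdiv hOo hOo' hx hy hx'.1 hy'.1 hx'D hy'D
      (by linear_combination hN - hk) hN
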